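/- Let $k$ be a field, and let $(A,\mathfrak m)$ and $(B,\mathfrak n)$ be noetherian local (commutative) $k$-algebras. Let $E=A\hat\otimes_k B$ be the completion of $A\otimes_k B$ for the topology defined by the powers of the ideal $\mathfrak m(A\otimes_k B)+\mathfrak n(A\otimes_k B)$. Suppose that $E$ is noetherian. Then: (i) $\dim E=\dim A+\dim B+\min\bigl(\operatorname{trdeg}_k(A/\mathfrak m),\operatorname{trdeg}_k(B/\mathfrak n)\bigr)$, where $\dim$ is the Krull dimension and infinite transcendence degrees are counted as $\infty$; (ii) $\dim E$ is finite if and only if $\operatorname{trdeg}_k(A/\mathfrak m)$ or $\operatorname{trdeg}_k(B/\mathfrak n)$ is finite. -/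

import Mathlib

open scoped TensorProduct

/-- The ideal `𝔞(A ⊗ B) + 𝔟(A ⊗ B)` of `A ⊗[k] B`. If `A` and `B` carry the `𝔞`-adic and the
`𝔟`-adic topology, this is an ideal of definition of the tensor product topology on `A ⊗[k] B`,
whose basic neighbourhoods of zero are the ideals `𝔞 ^ i (A ⊗ B) + 𝔟 ^ j (A ⊗ B)`. -/
def tensorIdeal (k : Type*) {A B : Type*} [CommRing k] [CommRing A] [CommRing B]
    [Algebra k A] [Algebra k B] (𝔞 : Ideal A) (𝔟 : Ideal B) : Ideal (A ⊗[k] B) :=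
  𝔞.map (Algebra.TensorProduct.includeLeft : A →ₐ[k] A ⊗[k] B) ⊔
    𝔟.map (Algebra.TensorProduct.includeRight : B →ₐ[k] A ⊗[k] B)

/-- The completed tensor product of the `k`-algebra `A` with its `𝔞`-adic topology and the
`k`-algebra `B` with its `𝔟`-adic topology: the completion `lim (A ⊗ B) / 𝔯 ^ n` of `A ⊗[k] B`
in the tensor product topology, where `𝔯 = 𝔞(A ⊗ B) + 𝔟(A ⊗ B)`. -/
abbrev CompletedTensorProduct (k : Type*) {A B : Type*} [CommRing k] [CommRing A] [CommRing B]
    [Algebra k A] [Algebra k B] (𝔞 : Ideal A) (𝔟 : Ideal B) : Type _ :=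
  AdicCompletion (tensorIdeal k 𝔞 𝔟) (A ⊗[k] B)

/-- The completed tensor product of two local `k`-algebras, each with the topology defined by the
powers of its maximal ideal. -/
abbrev LocalCompletedTensorProduct (k A B : Type*) [CommRing k] [CommRing A] [CommRing B]
    [IsLocalRing A] [IsLocalRing B] [Algebra k A] [Algebra k B] : Type _ :=
  CompletedTensorProduct k (IsLocalRing.maximalIdeal A) (IsLocalRing.maximalIdeal B)

/-- The transcendence degree of a `k`-algebra as an element of `ℕ∞`: every infinite transcendence
degree is `⊤`. -/
noncomputable def trdegENat (k K : Type*) [CommRing k] [CommRing K] [Algebra k K] : ℕ∞ :=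
  Cardinal.toENat (Algebra.trdeg k K)

/-! Let `K`, `L` be the residue fields. The formula splits into `dim E = dim A + dim B + dim (K ⊗
L)` and the computation of `dim (K ⊗ L)`.

Lower bound: if `x` is regular in `A`, Artin–Rees and flatness over `k` make `x ⊗ 1` regular in the
completed tensor product. Each step of a prime chain in `A` then costs at least one dimension on
passing to a quotient of `A`. Descending along maximal chains of `A` and of `B` ends at `K ⊗ L`.
Noetherianity of `E` plays no role here.

Upper bound: the extension of `𝔯 = 𝔪(A ⊗ B) + 𝔫(A ⊗ B)` to `E` lies in the Jacobson radical and, up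
to radical, is generated by parameters of `A` and `B`. As `E` is noetherian, killing these `dim A +
dim B` elements lowers the dimension by at most their number, and leaves the dimension of `E/𝔯E = K
⊗ L`.

Fields: `K ⊗ L` is integral over `k(x) ⊗ L`, a localization of a quotient of `L[x]`, which bounds
the dimension above. Below, identifying a transcendental of `K` with one of `L` kills a regular
element, and induction applies over `k(X)`. -/

/-! ### Functoriality of adic completion -/

namespace AdicCompletion

variable {R S : Type*} [CommRing R] [CommRing S]

theorem factorPow_comp_quotientMap_comp_evalₐ (I : Ideal R) (f : R →+* S) {m n : ℕ} (hle : m ≤ n) :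
    (Ideal.Quotient.factorPow (I.map f) hle).comp ((Ideal.quotientMap ((I.map f) ^ n) f
      (by rw [← Ideal.map_le_iff_le_comap, Ideal.map_pow])).comp (evalₐ I n : AdicCompletion I R →+* R ⧸ I ^ n)) =
    (Ideal.quotientMap ((I.map f) ^ m) f
      (by rw [← Ideal.map_le_iff_le_comap, Ideal.map_pow])).comp
        (evalₐ I m : AdicCompletion I R →+* R ⧸ I ^ m) := by
  ext z
  obtain ⟨z, rfl⟩ := mk_surjective I R z
  have h := congrArg (Ideal.quotientMap ((I.map f) ^ m) f
    (by rw [← Ideal.map_le_iff_le_comap, Ideal.map_pow])) (Ideal.mk_eq_mk I hle z)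
  simpa [Ideal.Quotient.factorPow] using h

/-- The ring homomorphism between adic completions induced by a ring homomorphism. -/
noncomputable def mapRingHom (I : Ideal R) (f : R →+* S) :
    AdicCompletion I R →+* AdicCompletion (I.map f) S :=
  liftRingHom (I.map f) _ (factorPow_comp_quotientMap_comp_evalₐ I f)

theorem mapRingHom_algebraMap (I : Ideal R) (f : R →+* S) (x : R) :
    mapRingHom I f (algebraMap R _ x) = algebraMap S _ (f x) := by
  refine ext_evalₐ fun n ↦ ?_
  exact (evalₐ_liftRingHom _ _ (factorPow_comp_quotientMap_comp_evalₐ I f) n _).trans (by simp)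

/-- From a complete source to a Hausdorff target, surjectivity modulo the ideal suffices. Finite
generation makes the completions complete and identifies the kernel of evaluation with the extended
ideal. -/
theorem mapRingHom_surjective {I : Ideal R} (hI : I.FG) {f : R →+* S}
    (hf : Function.Surjective f) : Function.Surjective (mapRingHom I f) := by
  have hE := isAdicComplete_self I hI
  have hE' := isAdicComplete_self (I.map f) (hI.map f)
  have hmap : (I.map (algebraMap R (AdicCompletion I R))).map (mapRingHom I f) =
      (I.map f).map (algebraMap S (AdicCompletion (I.map f) S)) := by
    rw [Ideal.map_map, Ideal.map_map]
    exact congrArg (I.map ·) (RingHom.ext (mapRingHom_algebraMap I f))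
  have : IsHausdorff ((I.map (algebraMap R (AdicCompletion I R))).map (mapRingHom I f))
      (AdicCompletion (I.map f) S) := by
    rw [hmap]; infer_instance
  refine surjective_of_mk_map_comp_surjective
    (I := I.map (algebraMap R (AdicCompletion I R))) (mapRingHom I f) fun y ↦ ?_
  obtain ⟨y, rfl⟩ := Ideal.Quotient.mk_surjective y
  obtain ⟨s, hs⟩ := Ideal.Quotient.mk_surjective (evalOneₐ (I.map f) y)
  obtain ⟨x, rfl⟩ := hf s
  refine ⟨algebraMap R _ x, ?_⟩
  rw [RingHom.comp_apply, mapRingHom_algebraMap, Ideal.Quotient.eq, hmap,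
    ← ker_evalOneₐ_eq_map _ (hI.map f), RingHom.mem_ker, map_sub, sub_eq_zero]
  exact hs

end AdicCompletion

/-! ### Regular elements in the completed tensor product -/

/-- Artin–Rees for `(x) ⊆ A` gives `I ^ (n + c) ∩ (x) ⊆ x I ^ n`; then cancel `x`. -/
theorem Ideal.exists_forall_mul_mem_pow_add {A : Type*} [CommRing A] [IsNoetherianRing A]
    (I : Ideal A) {x : A} (hx : x ∈ nonZeroDivisors A) :
    ∃ c, ∀ n a, x * a ∈ I ^ (n + c) → a ∈ I ^ n := by
  obtain ⟨c, hc⟩ := I.exists_pow_inf_eq_pow_smul (M := A) (Ideal.span {x})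
  refine ⟨c, fun n a ha ↦ ?_⟩
  have h : x * a ∈ I ^ (n + c - c) • (I ^ c • ⊤ ⊓ Ideal.span {x} : Ideal A) := by
    rw [← hc (n + c) (by omega)]
    exact ⟨by simpa using ha, Ideal.mul_mem_right _ _ (Ideal.mem_span_singleton_self x)⟩
  have h' : x * a ∈ I ^ n * Ideal.span {x} := by
    rw [Nat.add_sub_cancel] at h
    exact Ideal.mul_mono_right inf_le_right h
  rw [mul_comm, Ideal.mem_span_singleton_mul] at h'
  obtain ⟨b, hb, hba⟩ := h'
  rwa [← (mul_cancel_left_mem_nonZeroDivisors hx).mp hba]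

section

variable {k A B : Type*} [Field k] [CommRing A] [CommRing B] [Algebra k A] [Algebra k B]

theorem ker_tensorProduct_map_mk (I : Ideal A) (J : Ideal B) :
    RingHom.ker (Algebra.TensorProduct.map (Ideal.Quotient.mkₐ k I) (Ideal.Quotient.mkₐ k J)) =
      tensorIdeal k I J := by
  rw [Algebra.TensorProduct.map_ker _ _ (Ideal.Quotient.mkₐ_surjective k I)
    (Ideal.Quotient.mkₐ_surjective k J)]
  exact congrArg₂ (tensorIdeal k) (Ideal.Quotient.mkₐ_ker k I) (Ideal.Quotient.mkₐ_ker k J)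

theorem tensorIdeal_mono {I I' : Ideal A} {J J' : Ideal B} (h : I ≤ I') (h' : J ≤ J') :
    tensorIdeal k I J ≤ tensorIdeal k I' J' :=
  sup_le_sup (Ideal.map_mono h) (Ideal.map_mono h')

/-- Multiplication by `x` embeds `A ⧸ (I' : x)` into `A ⧸ I'`, and tensoring with `B ⧸ J` over the
field `k` keeps it injective. -/
theorem mem_tensorIdeal_of_tmul_one_mul_mem {x : A} {I I' : Ideal A} {J : Ideal B}
    (h : ∀ a, x * a ∈ I' → a ∈ I) {z : A ⊗[k] B} (hz : (x ⊗ₜ 1) * z ∈ tensorIdeal k I' J) :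
    z ∈ tensorIdeal k I J := by
  let I₀ : Ideal A := Submodule.comap (LinearMap.mulLeft A x) I'
  let ψ : A ⧸ I₀ →ₗ[k] A ⧸ I' :=
    (Submodule.mapQ I₀ I' (LinearMap.mulLeft A x) le_rfl).restrictScalars k
  have hψ : Function.Injective ψ := by
    refine LinearMap.ker_eq_bot.mp ?_
    have : LinearMap.ker (Submodule.mapQ I₀ I' (LinearMap.mulLeft A x) le_rfl) = ⊥ :=
      Submodule.ker_liftQ_eq_bot' _ _ (by simp [I₀, LinearMap.ker_comp])
    rw [LinearMap.ker_eq_bot] at this ⊢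
    exact this
  have hflat := Module.Flat.rTensor_preserves_injective_linearMap (M := B ⧸ J) ψ hψ
  have key : ∀ w : A ⊗[k] B, ψ.rTensor (B ⧸ J) (Algebra.TensorProduct.map
      (Ideal.Quotient.mkₐ k I₀) (Ideal.Quotient.mkₐ k J) w) =
      Algebra.TensorProduct.map (Ideal.Quotient.mkₐ k I') (Ideal.Quotient.mkₐ k J)
        ((x ⊗ₜ 1) * w) := by
    intro w
    induction w with
    | zero => simp
    | add u v hu hv => rw [map_add, map_add, mul_add, map_add, hu, hv]
    | tmul a b =>
      simp only [Algebra.TensorProduct.map_tmul, LinearMap.rTensor_tmul,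
        Algebra.TensorProduct.tmul_mul_tmul, one_mul]
      rfl
  refine tensorIdeal_mono (fun a ha ↦ h a ha) le_rfl (?_ : z ∈ tensorIdeal k I₀ J)
  rw [← ker_tensorProduct_map_mk, RingHom.mem_ker] at hz ⊢
  exact hflat (by rw [key, hz, map_zero])

theorem tensorIdeal_pow_le (I : Ideal A) (J : Ideal B) (n : ℕ) :
    tensorIdeal k (I ^ n) (J ^ n) ≤ tensorIdeal k I J ^ n := by
  rw [tensorIdeal, Ideal.map_pow, Ideal.map_pow]
  exact sup_le (Ideal.pow_right_mono le_sup_left n) (Ideal.pow_right_mono le_sup_right n)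

theorem pow_tensorIdeal_le (I : Ideal A) (J : Ideal B) (n : ℕ) :
    tensorIdeal k I J ^ (n + n) ≤ tensorIdeal k (I ^ n) (J ^ n) := by
  rw [tensorIdeal, tensorIdeal, Ideal.map_pow, Ideal.map_pow]
  exact Ideal.sup_pow_add_le_pow_sup_pow

theorem tensorIdeal_fg {I : Ideal A} {J : Ideal B} (hI : I.FG) (hJ : J.FG) :
    (tensorIdeal k I J).FG :=
  Submodule.FG.sup (hI.map _) (hJ.map _)

theorem algebraMap_tmul_one_mem_nonZeroDivisors [IsNoetherianRing A] (I : Ideal A) (J : Ideal B)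
    {x : A} (hx : x ∈ nonZeroDivisors A) :
    algebraMap (A ⊗[k] B) (CompletedTensorProduct k I J) (x ⊗ₜ 1) ∈
      nonZeroDivisors (CompletedTensorProduct k I J) := by
  obtain ⟨c, hc⟩ := I.exists_forall_mul_mem_pow_add hx
  rw [mem_nonZeroDivisors_iff_left]
  intro z hz
  obtain ⟨z, rfl⟩ := AdicCompletion.mk_surjective _ _ z
  refine AdicCompletion.ext_evalₐ fun n ↦ ?_
  -- The doubled index reflects that `tensorIdeal k I J ^ (m + m)` lies in `tensorIdeal k (I ^ m) (J
  -- ^ m)`; with `m = n + c`, dividing by `x` costs `c` in the exponent of `I`.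
  have h1 := congrArg (AdicCompletion.evalₐ _ ((n + c) + (n + c))) hz
  rw [map_mul, AdicCompletion.evalₐ_mk, map_zero, AlgHom.commutes, Ideal.Quotient.algebraMap_eq,
    ← map_mul, Ideal.Quotient.eq_zero_iff_mem] at h1
  have h2 : z ((n + c) + (n + c)) ∈ tensorIdeal k (I ^ n) (J ^ (n + c)) :=
    mem_tensorIdeal_of_tmul_one_mul_mem (hc n) (pow_tensorIdeal_le I J _ h1)
  have h3 := tensorIdeal_pow_le I J n
    (tensorIdeal_mono le_rfl (Ideal.pow_le_pow_right (Nat.le_add_right n c)) h2)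
  rw [AdicCompletion.evalₐ_mk, map_zero,
    ← AdicCompletion.Ideal.mk_eq_mk _ (show n ≤ (n + c) + (n + c) by omega) z,
    Ideal.Quotient.eq_zero_iff_mem]
  exact h3

end

/-! ### Lower bound: descending along chains of primes -/

section

variable {k A B : Type*} [Field k] [CommRing A] [CommRing B] [Algebra k A] [Algebra k B]

theorem map_tensorIdeal_map_id {C : Type*} [CommRing C] [Algebra k C] (I : Ideal A) (J : Ideal B)
    (f : A →ₐ[k] C) :
    (tensorIdeal k I J).map (Algebra.TensorProduct.map f (AlgHom.id k B)).toRingHom =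
      tensorIdeal k (I.map f) J := by
  have h1 : (Algebra.TensorProduct.map f (AlgHom.id k B)).toRingHom.comp
      (Algebra.TensorProduct.includeLeft : A →ₐ[k] A ⊗[k] B).toRingHom =
      (Algebra.TensorProduct.includeLeft : C →ₐ[k] C ⊗[k] B).toRingHom.comp f.toRingHom := by
    ext; simp
  have h2 : (Algebra.TensorProduct.map f (AlgHom.id k B)).toRingHom.comp
      (Algebra.TensorProduct.includeRight : B →ₐ[k] A ⊗[k] B).toRingHom =
      (Algebra.TensorProduct.includeRight : B →ₐ[k] C ⊗[k] B).toRingHom := by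
    ext; simp
  refine (Ideal.map_sup _ _ _).trans (congrArg₂ (· ⊔ ·) ?_ ?_)
  · refine (Ideal.map_map _ _).trans (Eq.trans ?_ (Ideal.map_map _ _).symm)
    exact congrArg (I.map ·) h1
  · exact (Ideal.map_map _ _).trans (congrArg (J.map ·) h2)

theorem map_tensorIdeal_comm (I : Ideal A) (J : Ideal B) :
    (tensorIdeal k I J).map (Algebra.TensorProduct.comm k A B).toAlgHom.toRingHom =
      tensorIdeal k J I := by
  have h1 : (Algebra.TensorProduct.comm k A B).toAlgHom.toRingHom.comp
      (Algebra.TensorProduct.includeLeft : A →ₐ[k] A ⊗[k] B).toRingHom =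
      (Algebra.TensorProduct.includeRight : A →ₐ[k] B ⊗[k] A).toRingHom := by
    ext; simp
  have h2 : (Algebra.TensorProduct.comm k A B).toAlgHom.toRingHom.comp
      (Algebra.TensorProduct.includeRight : B →ₐ[k] A ⊗[k] B).toRingHom =
      (Algebra.TensorProduct.includeLeft : B →ₐ[k] B ⊗[k] A).toRingHom := by
    ext; simp
  refine (Ideal.map_sup _ _ _).trans (Eq.trans (congrArg₂ (· ⊔ ·) ?_ ?_) (sup_comm _ _))
  · exact (Ideal.map_map _ _).trans (congrArg (I.map ·) h1)
  · exact (Ideal.map_map _ _).trans (congrArg (J.map ·) h2)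

theorem exists_surjective_completedTensorProduct_map {C : Type*} [CommRing C] [Algebra k C]
    {I : Ideal A} {J : Ideal B} (hI : I.FG) (hJ : J.FG) {f : A →ₐ[k] C}
    (hf : Function.Surjective f) :
    ∃ g : CompletedTensorProduct k I J →+* CompletedTensorProduct k (I.map f) J,
      Function.Surjective g ∧ ∀ a : A, g (algebraMap (A ⊗[k] B) _ (a ⊗ₜ 1)) =
        algebraMap (C ⊗[k] B) _ (f a ⊗ₜ 1) := by
  have hs : Function.Surjective (Algebra.TensorProduct.map f (AlgHom.id k B)).toRingHom :=
    TensorProduct.map_surjective hf Function.surjective_id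
  have h := AdicCompletion.mapRingHom_surjective (tensorIdeal_fg (k := k) hI hJ) hs
  have h' := AdicCompletion.mapRingHom_algebraMap (tensorIdeal k I J)
    (Algebra.TensorProduct.map f (AlgHom.id k B)).toRingHom
  -- The type of the map mentions the image ideal, so the map is generalized before that ideal is
  -- rewritten.
  generalize AdicCompletion.mapRingHom (tensorIdeal k I J)
    (Algebra.TensorProduct.map f (AlgHom.id k B)).toRingHom = g at h h'
  revert g
  rw [map_tensorIdeal_map_id]
  intro g h h'
  exact ⟨g, h, fun a ↦ (h' _).trans (by simp)⟩

theorem ringKrullDim_completedTensorProduct_comm_le {I : Ideal A} {J : Ideal B} (hI : I.FG)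
    (hJ : J.FG) : ringKrullDim (CompletedTensorProduct k J I) ≤
      ringKrullDim (CompletedTensorProduct k I J) := by
  have h := AdicCompletion.mapRingHom_surjective (tensorIdeal_fg (k := k) hI hJ)
    (f := (Algebra.TensorProduct.comm k A B).toAlgHom.toRingHom)
    (Algebra.TensorProduct.comm k A B).surjective
  have h' := ringKrullDim_le_of_surjective _ h
  rwa [map_tensorIdeal_comm] at h'

/-- A prime chain in `R` above the ideal `I` yields a prime chain in `R ⧸ I`. -/
theorem exists_ltSeries_primeSpectrum_quotient {R : Type*} [CommRing R] (I : Ideal R)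
    (l : LTSeries (PrimeSpectrum R)) (hl : I ≤ l.head.asIdeal) :
    ∃ l' : LTSeries (PrimeSpectrum (R ⧸ I)), l'.length = l.length ∧
      l'.last.asIdeal.comap (Ideal.Quotient.mk I) = l.last.asIdeal := by
  have hle (i) : l i ∈ PrimeSpectrum.zeroLocus (R := R) I :=
    hl.trans (LTSeries.head_le l i)
  let e := I.primeSpectrumQuotientOrderIsoZeroLocus
  refine ⟨⟨l.length, fun i ↦ e.symm ⟨l i, hle i⟩, fun i ↦ ?_⟩, rfl, ?_⟩
  · exact e.symm.strictMono (l.step i)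
  · have := e.apply_symm_apply ⟨l (Fin.last _), hle _⟩
    exact congrArg (fun p ↦ p.1.asIdeal) this

/-- For a chain `p < p₁ < ⋯`, an element `x` of `p₁` outside `p` is regular in the domain `A ⧸ p`.
So passing from `A ⧸ p` to `A ⧸ (p + (x))` loses at least one dimension, and the chain from `p₁` on
survives there. The ring `A` varies in the induction. -/
theorem length_add_ringKrullDim_completedTensorProduct_le {C : Type*} [CommRing C] [Algebra k C]
    {J : Ideal B} (hJ : J.FG) (n : ℕ) :
    ∀ {A : Type*} [CommRing A] [Algebra k A] [IsNoetherianRing A] (I : Ideal A) (f : A →ₐ[k] C)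
      (_ : Function.Surjective f) (l : LTSeries (PrimeSpectrum A)) (_ : l.length = n)
      (_ : l.last.asIdeal ≤ RingHom.ker f),
      n + ringKrullDim (CompletedTensorProduct k (I.map f) J) ≤
        ringKrullDim (CompletedTensorProduct k I J) := by
  induction n with
  | zero =>
    intro A _ _ _ I f hf l _ _
    obtain ⟨g, hg, -⟩ := exists_surjective_completedTensorProduct_map (k := k)
      (IsNoetherian.noetherian I) hJ hf
    simpa using ringKrullDim_le_of_surjective g hg
  | succ n ih =>
    intro A _ _ _ I f hf l hl hlf
    have : NeZero l.length := ⟨by omega⟩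
    let p := l.head.asIdeal
    let t := l.tail (by omega)
    have hlt : p < t.head.asIdeal := by
      rw [RelSeries.head_tail]
      exact l.rel_of_lt (i := 0) (j := 1) (by simp)
    obtain ⟨x, hxt, hxp⟩ := Set.exists_of_ssubset hlt
    let q : Ideal A := p ⊔ Ideal.span {x}
    have hqt : q ≤ t.head.asIdeal := sup_le hlt.le (by simpa using hxt)
    obtain ⟨l', hl', hlast⟩ := exists_ltSeries_primeSpectrum_quotient q t hqt
    have hqf : ∀ a ∈ q, f a = 0 := fun a ha ↦ hlf (by
      have := hqt.trans (LTSeries.head_le_last t) ha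
      simpa [t] using this)
    let f' : A ⧸ q →ₐ[k] C := Ideal.Quotient.liftₐ q f hqf
    have hf' : Function.Surjective f' := Ideal.Quotient.lift_surjective_of_surjective _ hqf hf
    let r : (A ⧸ p) →ₐ[k] A ⧸ q := Ideal.Quotient.factorₐ k le_sup_left
    have hr : Function.Surjective r := Ideal.Quotient.factor_surjective le_sup_left
    obtain ⟨g₁, hg₁, -⟩ := exists_surjective_completedTensorProduct_map (k := k)
      (IsNoetherian.noetherian I) hJ (Ideal.Quotient.mkₐ_surjective k p)
    obtain ⟨g₂, hg₂, hg₂x⟩ := exists_surjective_completedTensorProduct_map (k := k)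
      (IsNoetherian.noetherian (I.map (Ideal.Quotient.mkₐ k p))) hJ hr
    have hx0 : (Ideal.Quotient.mk p x) ∈ nonZeroDivisors (A ⧸ p) :=
      mem_nonZeroDivisors_of_ne_zero (by rwa [Ne, Ideal.Quotient.eq_zero_iff_mem])
    have hrx : r (Ideal.Quotient.mk p x) = 0 :=
      Ideal.Quotient.eq_zero_iff_mem.mpr (Ideal.mem_sup_right (Ideal.mem_span_singleton_self x))
    have h1 := ringKrullDim_succ_le_of_surjective g₂ hg₂
      (algebraMap_tmul_one_mem_nonZeroDivisors _ _ hx0)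
      (by rw [hg₂x, hrx, TensorProduct.zero_tmul, map_zero])
    have h2 := ih ((I.map (Ideal.Quotient.mkₐ k p)).map r) f' hf' l' (by simp [hl', t, hl]) (by
      intro y hy
      obtain ⟨a, rfl⟩ := Ideal.Quotient.mk_surjective y
      have : a ∈ t.last.asIdeal := hlast ▸ hy
      exact hlf (by simpa [t] using this))
    have h3 : ((I.map (Ideal.Quotient.mkₐ k p)).map r).map f' = I.map f := by
      refine (congrArg (Ideal.map f') (Ideal.map_map _ _)).trans ((Ideal.map_map _ _).trans ?_)
      exact congrArg (I.map ·) (RingHom.ext fun a ↦ rfl)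
    rw [h3] at h2
    refine le_trans ?_ (h1.trans (ringKrullDim_le_of_surjective g₁ hg₁))
    rw [Nat.cast_succ, add_right_comm]
    gcongr

theorem exists_ltSeries_length_eq_ringKrullDim (R : Type*) [CommRing R] [FiniteRingKrullDim R] :
    ∃ l : LTSeries (PrimeSpectrum R), (l.length : WithBot ℕ∞) = ringKrullDim R :=
  ⟨_, (Order.krullDim_eq_length_of_finiteDimensionalOrder).symm⟩

end

section

open IsLocalRing

variable (k A B : Type*) [Field k] [CommRing A] [CommRing B] [IsLocalRing A] [IsLocalRing B]
  [IsNoetherianRing A] [IsNoetherianRing B] [Algebra k A] [Algebra k B]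

theorem add_ringKrullDim_tensorProduct_residueField_le :
    ringKrullDim A + ringKrullDim B + ringKrullDim (ResidueField A ⊗[k] ResidueField B) ≤
      ringKrullDim (LocalCompletedTensorProduct k A B) := by
  obtain ⟨l, hl⟩ := exists_ltSeries_length_eq_ringKrullDim A
  obtain ⟨l', hl'⟩ := exists_ltSeries_length_eq_ringKrullDim B
  let f := IsScalarTower.toAlgHom k A (ResidueField A)
  let f' := IsScalarTower.toAlgHom k B (ResidueField B)
  have hf : Function.Surjective f := residue_surjective
  have hf' : Function.Surjective f' := residue_surjective
  have hA := (IsNoetherian.noetherian (maximalIdeal A))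
  have hB := (IsNoetherian.noetherian (maximalIdeal B))
  have hker : RingHom.ker f = maximalIdeal A := ker_residue
  have hker' : RingHom.ker f' = maximalIdeal B := ker_residue
  have h1 := length_add_ringKrullDim_completedTensorProduct_le (k := k) hB l.length
    (maximalIdeal A) f hf l rfl (hker ▸ le_maximalIdeal l.last.isPrime.ne_top)
  have h2 := ringKrullDim_completedTensorProduct_comm_le (k := k)
    (IsNoetherian.noetherian ((maximalIdeal A).map f)) hB
  have h3 := length_add_ringKrullDim_completedTensorProduct_le (k := k)
    (IsNoetherian.noetherian ((maximalIdeal A).map f)) l'.length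
    (maximalIdeal B) f' hf' l' rfl (hker' ▸ le_maximalIdeal l'.last.isPrime.ne_top)
  -- Over the residue fields the ideal of definition vanishes, so evaluation maps the completion
  -- onto their tensor product.
  have h4 : tensorIdeal k ((maximalIdeal B).map f') ((maximalIdeal A).map f) = ⊥ := by
    rw [← hker, ← hker', (Ideal.map_eq_bot_iff_le_ker f).mpr le_rfl,
      (Ideal.map_eq_bot_iff_le_ker f').mpr le_rfl]
    simp [tensorIdeal]
  have h5 : ringKrullDim (ResidueField A ⊗[k] ResidueField B) ≤ ringKrullDim
      (CompletedTensorProduct k ((maximalIdeal B).map f') ((maximalIdeal A).map f)) := by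
    let e := (Algebra.TensorProduct.comm k (ResidueField A) (ResidueField B)).toRingEquiv.trans
      ((RingEquiv.quotientBot _).symm.trans (Ideal.quotEquivOfEq h4.symm))
    rw [ringKrullDim_eq_of_ringEquiv e]
    exact ringKrullDim_le_of_surjective _ (AdicCompletion.evalOneₐ_surjective _)
  rw [hl] at h1
  rw [hl'] at h3
  calc _ = ringKrullDim A + (ringKrullDim B + _) := add_assoc _ _ _
    _ ≤ _ := le_trans (by gcongr; exact (by gcongr : _ ≤ _).trans (h3.trans h2)) h1

end

/-! ### Upper bound: systems of parameters -/

section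

open IsLocalRing

/-- A system of parameters, from the converse of Krull's height theorem: the maximal ideal is
minimal over as many elements as its height. -/
theorem IsLocalRing.exists_finset_card_eq_ringKrullDim (A : Type*) [CommRing A] [IsLocalRing A]
    [IsNoetherianRing A] : ∃ s : Finset A, (s.card : WithBot ℕ∞) = ringKrullDim A ∧
      (s : Set A) ⊆ maximalIdeal A ∧ maximalIdeal A ≤ (Ideal.span (s : Set A)).radical := by
  obtain ⟨s, hs, hc⟩ := (maximalIdeal A).exists_finset_card_eq_height_of_isNoetherianRing
  refine ⟨s, ?_, Ideal.span_le.mp hs.1.2, ?_⟩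
  · rw [← maximalIdeal_height_eq_ringKrullDim, ← hc]
    rfl
  · rw [Ideal.radical_eq_sInf]
    exact le_sInf fun p ⟨hp, hpp⟩ ↦ hs.2 ⟨hpp, hp⟩ (le_maximalIdeal hpp.ne_top)

theorem ringKrullDim_quotient_tensorIdeal_maximalIdeal
    (k A B : Type*) [Field k] [CommRing A] [CommRing B] [IsLocalRing A] [IsLocalRing B]
    [Algebra k A] [Algebra k B] :
    ringKrullDim (A ⊗[k] B ⧸ tensorIdeal k (maximalIdeal A) (maximalIdeal B)) =
      ringKrullDim (ResidueField A ⊗[k] ResidueField B) := by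
  rw [← ker_tensorProduct_map_mk]
  exact ringKrullDim_eq_of_ringEquiv (RingHom.quotientKerEquivOfSurjective
    (TensorProduct.map_surjective (Ideal.Quotient.mkₐ_surjective k _)
      (Ideal.Quotient.mkₐ_surjective k _)))

variable (k A B : Type*) [Field k] [CommRing A] [CommRing B] [IsLocalRing A] [IsLocalRing B]
  [IsNoetherianRing A] [IsNoetherianRing B] [Algebra k A] [Algebra k B]

theorem ringKrullDim_le_add_ringKrullDim_tensorProduct_residueField
    [IsNoetherianRing (LocalCompletedTensorProduct k A B)] :
    ringKrullDim (LocalCompletedTensorProduct k A B) ≤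
      ringKrullDim A + ringKrullDim B + ringKrullDim (ResidueField A ⊗[k] ResidueField B) := by
  classical
  obtain ⟨s, hs, hsm, hsr⟩ := exists_finset_card_eq_ringKrullDim A
  obtain ⟨t, ht, htm, htr⟩ := exists_finset_card_eq_ringKrullDim B
  let r := tensorIdeal k (maximalIdeal A) (maximalIdeal B)
  have hr : r.FG := tensorIdeal_fg (IsNoetherian.noetherian _) (IsNoetherian.noetherian _)
  let E := LocalCompletedTensorProduct k A B
  let φ : A ⊗[k] B →+* E := algebraMap _ _
  let i : A →+* E := φ.comp (Algebra.TensorProduct.includeLeft : A →ₐ[k] A ⊗[k] B).toRingHom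
  let j : B →+* E := φ.comp (Algebra.TensorProduct.includeRight : B →ₐ[k] A ⊗[k] B).toRingHom
  have hrE : r.map φ = (maximalIdeal A).map i ⊔ (maximalIdeal B).map j := by
    refine (Ideal.map_sup _ _ _).trans ?_
    exact congrArg₂ (· ⊔ ·) (Ideal.map_map _ _) (Ideal.map_map _ _)
  have hcomp : IsAdicComplete (r.map φ) E := AdicCompletion.isAdicComplete_self r hr
  have hjac : r.map φ ≤ Ring.jacobson E := by
    rw [← Ideal.jacobson_bot]
    exact IsAdicComplete.le_jacobson_bot (r.map φ)
  let u : Finset E := s.image i ∪ t.image j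
  have hu : (u : Set E) ⊆ r.map φ := by
    intro y hy
    rw [hrE]
    simp only [u, Finset.coe_union, Finset.coe_image, Set.mem_union] at hy
    rcases hy with ⟨a, ha, rfl⟩ | ⟨b, hb, rfl⟩
    · exact Ideal.mem_sup_left (Ideal.mem_map_of_mem i (hsm ha))
    · exact Ideal.mem_sup_right (Ideal.mem_map_of_mem j (htm hb))
  have hcard : u.card ≤ s.card + t.card :=
    (Finset.card_union_le _ _).trans (add_le_add Finset.card_image_le Finset.card_image_le)
  have hru : r.map φ ≤ (Ideal.span (u : Set E)).radical := by
    rw [hrE]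
    refine sup_le ((Ideal.map_mono hsr).trans ((Ideal.map_radical_le i).trans ?_))
      ((Ideal.map_mono htr).trans ((Ideal.map_radical_le j).trans ?_)) <;>
    · rw [Ideal.map_span]
      exact Ideal.radical_mono (Ideal.span_mono (by simp [u]))
  -- This is where `E` must be noetherian.
  have h1 : ringKrullDim E ≤ ringKrullDim (E ⧸ Ideal.span (u : Set E)) + u.card :=
    ringKrullDim_le_ringKrullDim_quotient_add_card u (hu.trans hjac)
  have h2 : ringKrullDim (E ⧸ Ideal.span (u : Set E)) ≤ ringKrullDim (E ⧸ r.map φ) := by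
    rw [ringKrullDim_quotient, ringKrullDim_quotient, ← PrimeSpectrum.zeroLocus_radical]
    exact Order.krullDim_le_of_strictMono
      (Set.inclusion (PrimeSpectrum.zeroLocus_anti_mono_ideal hru)) fun _ _ h ↦ h
  have h3 : ringKrullDim (E ⧸ r.map φ) = ringKrullDim (A ⊗[k] B ⧸ r) := by
    rw [← AdicCompletion.ker_evalOneₐ_eq_map r hr]
    exact ringKrullDim_eq_of_ringEquiv (RingHom.quotientKerEquivOfSurjective
      (AdicCompletion.evalOneₐ_surjective r))
  rw [← hs, ← ht, ← ringKrullDim_quotient_tensorIdeal_maximalIdeal]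
  calc ringKrullDim E ≤ ringKrullDim (A ⊗[k] B ⧸ r) + u.card := by
        rw [← h3]
        exact h1.trans (by gcongr)
    _ ≤ ringKrullDim (A ⊗[k] B ⧸ r) + (s.card + t.card : ℕ) := by gcongr
    _ = _ := by rw [add_comm]; push_cast; rfl

end

/-! ### Dimension of a tensor product of fields -/

theorem ringKrullDim_le_of_isIntegral (R S : Type*) [CommRing R] [CommRing S] [Algebra R S]
    [Algebra.IsIntegral R S] : ringKrullDim S ≤ ringKrullDim R :=
  Order.krullDim_le_of_strictMono (PrimeSpectrum.comap (algebraMap R S)) fun _ _ h ↦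
    Ideal.IsIntegral.comap_lt_comap h

/-- Up to units every element comes from `R`, so contraction is injective on primes, as for a
localization. -/
theorem ringKrullDim_le_of_forall_exists_isUnit_mul_mem_range {R S : Type*} [CommRing R]
    [CommRing S] (φ : R →+* S) (h : ∀ z, ∃ u, IsUnit u ∧ u * z ∈ φ.range) :
    ringKrullDim S ≤ ringKrullDim R := by
  refine Order.krullDim_le_of_strictMono (PrimeSpectrum.comap φ) fun p q hpq ↦ ?_
  refine lt_of_le_of_ne (Ideal.comap_mono hpq.le) fun heq ↦ hpq.not_ge fun z hz ↦ ?_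
  obtain ⟨u, hu, r, hr⟩ := h z
  have hrq : r ∈ (PrimeSpectrum.comap φ q).asIdeal := by
    change φ r ∈ q.asIdeal
    rw [hr]
    exact Ideal.mul_mem_left _ _ hz
  rw [← heq] at hrq
  change φ r ∈ p.asIdeal at hrq
  rw [hr] at hrq
  exact (Ideal.unit_mul_mem_iff_mem _ hu).mp hrq

theorem ringKrullDim_tensorProduct_comm (k K L : Type*) [CommRing k] [CommRing K] [CommRing L]
    [Algebra k K] [Algebra k L] :
    ringKrullDim (K ⊗[k] L) = ringKrullDim (L ⊗[k] K) :=
  ringKrullDim_eq_of_ringEquiv (Algebra.TensorProduct.comm k K L).toRingEquiv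

/-- If every element of `F` is a quotient of polynomials in the family `x`, then `F ⊗ L` has
dimension at most the number of members of `x`. -/
theorem ringKrullDim_tensorProduct_le_natCard {k F : Type*} (L : Type*) [Field k] [Field F]
    [Field L] [Algebra k F] [Algebra k L] {ι : Type*} [Finite ι] (x : ι → F)
    (hx : ∀ f, ∃ r s : MvPolynomial ι k, MvPolynomial.aeval x s ≠ 0 ∧
      MvPolynomial.aeval x s * f = MvPolynomial.aeval x r) :
    ringKrullDim (F ⊗[k] L) ≤ Nat.card ι := by
  let φ : MvPolynomial ι L →+* F ⊗[k] L :=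
    MvPolynomial.eval₂Hom (Algebra.TensorProduct.includeRight : L →ₐ[k] F ⊗[k] L).toRingHom
      fun i ↦ x i ⊗ₜ 1
  have hC (l : L) : φ (MvPolynomial.C l) = 1 ⊗ₜ l := MvPolynomial.eval₂_C _ _ _
  have hX (i : ι) : φ (MvPolynomial.X i) = x i ⊗ₜ 1 := MvPolynomial.eval₂_X _ _ _
  have hφ (p : MvPolynomial ι k) :
      φ (MvPolynomial.map (algebraMap k L) p) = MvPolynomial.aeval x p ⊗ₜ 1 := by
    induction p using MvPolynomial.induction_on with
    | C a =>
      rw [MvPolynomial.map_C, hC, MvPolynomial.aeval_C]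
      exact (Algebra.TensorProduct.tmul_one_eq_one_tmul a).symm
    | add p q hp hq => rw [map_add, map_add, hp, hq, map_add, TensorProduct.add_tmul]
    | mul_X p i hp =>
      rw [map_mul, map_mul, hp, MvPolynomial.map_X, hX, map_mul, MvPolynomial.aeval_X,
        Algebra.TensorProduct.tmul_mul_tmul, mul_one]
  -- Common denominators: a product of denominators clears a sum of pure tensors.
  have key : ∀ z : F ⊗[k] L, ∃ q : MvPolynomial ι k, MvPolynomial.aeval x q ≠ 0 ∧
      (MvPolynomial.aeval x q ⊗ₜ 1) * z ∈ φ.range := by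
    intro z
    induction z with
    | zero => exact ⟨1, by simp, by simp⟩
    | tmul f l =>
      obtain ⟨r, s, hs, hrs⟩ := hx f
      refine ⟨s, hs, MvPolynomial.map (algebraMap k L) r * MvPolynomial.C l, ?_⟩
      rw [map_mul, hφ, hC, Algebra.TensorProduct.tmul_mul_tmul,
        Algebra.TensorProduct.tmul_mul_tmul, hrs, mul_one]
    | add z w hz hw =>
      obtain ⟨p, hp, hpz⟩ := hz
      obtain ⟨q, hq, hqw⟩ := hw
      refine ⟨p * q, by rw [map_mul]; exact mul_ne_zero hp hq, ?_⟩
      have h1 : (MvPolynomial.aeval x (p * q) ⊗ₜ[k] (1 : L)) =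
          (MvPolynomial.aeval x p ⊗ₜ 1) * (MvPolynomial.aeval x q ⊗ₜ 1) := by
        rw [Algebra.TensorProduct.tmul_mul_tmul, map_mul, mul_one]
      rw [mul_add, h1]
      refine add_mem ?_ ?_
      · rw [mul_right_comm]
        exact mul_mem hpz ⟨_, hφ q⟩
      · rw [mul_assoc]
        exact mul_mem ⟨_, hφ p⟩ hqw
  have h := ringKrullDim_le_of_forall_exists_isUnit_mul_mem_range φ fun z ↦
    let ⟨q, hq, hqz⟩ := key z
    ⟨_, (isUnit_iff_ne_zero.mpr hq).map
      (Algebra.TensorProduct.includeLeft : F →ₐ[k] F ⊗[k] L), hqz⟩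
  rwa [MvPolynomial.ringKrullDim_of_isNoetherianRing, ringKrullDim_eq_zero_of_field,
    zero_add] at h

theorem IntermediateField.exists_aeval_mul_eq_aeval_of_adjoin_range {k K ι : Type*} [Field k]
    [Field K] [Algebra k K] (x : ι → K) (f : adjoin k (Set.range x)) :
    ∃ r s : MvPolynomial ι k,
      MvPolynomial.aeval (fun i ↦ (⟨x i, subset_adjoin _ _ ⟨i, rfl⟩⟩ : adjoin k (Set.range x))) s
        ≠ 0 ∧
      MvPolynomial.aeval (fun i ↦ (⟨x i, subset_adjoin _ _ ⟨i, rfl⟩⟩ : adjoin k (Set.range x))) s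
        * f =
      MvPolynomial.aeval (fun i ↦ (⟨x i, subset_adjoin _ _ ⟨i, rfl⟩⟩ : adjoin k (Set.range x)))
        r := by
  set x' : ι → adjoin k (Set.range x) := fun i ↦ ⟨x i, subset_adjoin _ _ ⟨i, rfl⟩⟩
  have hx' (p : MvPolynomial ι k) : (MvPolynomial.aeval x' p : K) = MvPolynomial.aeval x p :=
    (MvPolynomial.aeval_algebraMap_apply (B := K) x' p).symm
  obtain ⟨r, s, hrs⟩ := (mem_adjoin_range_iff k x f).mp f.2
  rw [← hx', ← hx'] at hrs
  -- The membership criterion allows a zero denominator; then division by zero gives `f = 0`.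
  by_cases hs : MvPolynomial.aeval x' s = 0
  · have hf : f = 0 := Subtype.ext (by rw [hrs, hs]; simp)
    exact ⟨0, 1, by simp, by simp [hf]⟩
  · refine ⟨r, s, hs, Subtype.ext ?_⟩
    have : (MvPolynomial.aeval x' s : K) ≠ 0 := fun h ↦ hs (Subtype.ext h)
    rw [MulMemClass.coe_mul, hrs]
    field_simp

/-- `K ⊗[k] L` is `K ⊗[F] (F ⊗[k] L)`, hence integral over `F ⊗[k] L`. -/
theorem ringKrullDim_tensorProduct_le_of_isAlgebraic (k F K L : Type*) [Field k] [Field F]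
    [Field K] [Field L] [Algebra k F] [Algebra k K] [Algebra k L] [Algebra F K]
    [IsScalarTower k F K] [Algebra.IsAlgebraic F K] :
    ringKrullDim (K ⊗[k] L) ≤ ringKrullDim (F ⊗[k] L) := by
  rw [ringKrullDim_eq_of_ringEquiv
    ((Algebra.TensorProduct.cancelBaseChange k F F K L).symm.toRingEquiv.trans
      (Algebra.TensorProduct.comm F K (F ⊗[k] L)).toRingEquiv)]
  exact ringKrullDim_le_of_isIntegral _ _

theorem ringKrullDim_tensorProduct_le_trdegENat (k K L : Type*) [Field k] [Field K] [Field L]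
    [Algebra k K] [Algebra k L] :
    ringKrullDim (K ⊗[k] L) ≤ (trdegENat k K : WithBot ℕ∞) := by
  obtain ⟨s, hs⟩ := exists_isTranscendenceBasis k K
  rw [trdegENat, ← hs.cardinalMk_eq_trdeg]
  rcases finite_or_infinite s with hfin | hinf
  · have : Algebra.IsAlgebraic (IntermediateField.adjoin k (Set.range ((↑) : s → K))) K :=
      hs.isAlgebraic_field
    have h1 := ringKrullDim_tensorProduct_le_of_isAlgebraic k
      (IntermediateField.adjoin k (Set.range ((↑) : s → K))) K L
    have h2 := ringKrullDim_tensorProduct_le_natCard L _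
      (IntermediateField.exists_aeval_mul_eq_aeval_of_adjoin_range (k := k) ((↑) : s → K))
    refine (h1.trans h2).trans ?_
    rw [← Nat.cast_card, map_natCast]
    rfl
  · rw [Cardinal.toENat_eq_top.mpr (Cardinal.aleph0_le_mk s)]
    exact le_top

/-- Flat base change along `S → L` keeps multiplication by `w` injective. -/
theorem cancelBaseChange_one_tmul_mem_nonZeroDivisors {k S L K : Type*} [CommRing k] [CommRing S]
    [CommRing L] [CommRing K] [Algebra k S] [Algebra k L] [Algebra k K] [Algebra S L]
    [IsScalarTower k S L] [Module.Flat S L] {w : S ⊗[k] K} (hw : w ∈ nonZeroDivisors (S ⊗[k] K)) :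
    Algebra.TensorProduct.cancelBaseChange k S S L K (1 ⊗ₜ w) ∈ nonZeroDivisors (L ⊗[k] K) := by
  have hinj : Function.Injective ((LinearMap.mulLeft S w).lTensor L) :=
    Module.Flat.lTensor_preserves_injective_linearMap _ fun a b hab ↦
      (mul_cancel_left_mem_nonZeroDivisors hw).mp hab
  have hmul (z : L ⊗[S] (S ⊗[k] K)) :
      (LinearMap.mulLeft S w).lTensor L z = (1 ⊗ₜ w) * z := by
    induction z with
    | zero => rw [map_zero, mul_zero]
    | add a b ha hb => rw [map_add, mul_add, ha, hb]
    | tmul a b =>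
      rw [Algebra.TensorProduct.tmul_mul_tmul, LinearMap.lTensor_tmul, one_mul,
        LinearMap.mulLeft_apply]
  rw [mem_nonZeroDivisors_iff_left]
  intro z hz
  obtain ⟨z, rfl⟩ := (Algebra.TensorProduct.cancelBaseChange k S S L K).surjective z
  rw [← map_mul, EmbeddingLike.map_eq_zero_iff, ← hmul] at hz
  rw [hinj (hz.trans (map_zero _).symm), map_zero]

theorem X_tmul_one_sub_one_tmul_mem_nonZeroDivisors {k K : Type*} [Field k] [Field K]
    [Algebra k K] (x : K) :
    (.X ⊗ₜ 1 - 1 ⊗ₜ x : Polynomial k ⊗[k] K) ∈ nonZeroDivisors (Polynomial k ⊗[k] K) := by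
  let e := (polyEquivTensor k K).trans (Algebra.TensorProduct.comm k K (Polynomial k))
  have he : e (.X - .C x) = .X ⊗ₜ 1 - 1 ⊗ₜ x := by
    have h1 : (polyEquivTensor k K).symm (1 ⊗ₜ .X - x ⊗ₜ 1) = .X - .C x := by
      rw [map_sub, polyEquivTensor_symm_apply_tmul_eq_smul,
        polyEquivTensor_symm_apply_tmul_eq_smul]
      simp [Polynomial.smul_eq_C_mul]
    rw [← h1]
    simp [e]
  have hX : (.X - .C x : Polynomial K) ∈ nonZeroDivisors (Polynomial K) :=
    (Polynomial.monic_X_sub_C x).mem_nonZeroDivisors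
  rw [mem_nonZeroDivisors_iff_left] at hX ⊢
  intro z hz
  obtain ⟨z, rfl⟩ := e.surjective z
  rw [← he, ← map_mul, EmbeddingLike.map_eq_zero_iff] at hz
  rw [hX z hz, map_zero]

/-- Via `X ↦ y`, `L` is torsion-free, hence flat, over `k[X]`. The element is the base change of `X
- x`, which is monic in `K[X] = k[X] ⊗ K`. -/
theorem tmul_one_sub_one_tmul_mem_nonZeroDivisors {k K L : Type*} [Field k] [Field K] [Field L]
    [Algebra k K] [Algebra k L] {y : L} (hy : Transcendental k y) (x : K) :
    (y ⊗ₜ 1 - 1 ⊗ₜ x : L ⊗[k] K) ∈ nonZeroDivisors (L ⊗[k] K) := by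
  let : Algebra (Polynomial k) L := (Polynomial.aeval y).toAlgebra
  have : IsScalarTower k (Polynomial k) L :=
    IsScalarTower.of_algebraMap_eq fun a ↦ ((Polynomial.aeval y).commutes a).symm
  have : FaithfulSMul (Polynomial k) L :=
    (faithfulSMul_iff_algebraMap_injective (Polynomial k) L).mpr
      (transcendental_iff_injective.mp hy)
  have hflat : Module.Flat (Polynomial k) L := by
    rw [Module.Flat.flat_iff_torsion_eq_bot_of_isBezout,
      ← Submodule.isTorsionFree_iff_torsion_eq_bot]
    infer_instance
  have hX : (.X : Polynomial k) • (1 : L) = y := by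
    rw [Algebra.smul_def, mul_one]
    exact Polynomial.aeval_X y
  have h := cancelBaseChange_one_tmul_mem_nonZeroDivisors (L := L)
    (X_tmul_one_sub_one_tmul_mem_nonZeroDivisors (k := k) x)
  rwa [TensorProduct.tmul_sub, map_sub, Algebra.TensorProduct.cancelBaseChange_tmul,
    Algebra.TensorProduct.cancelBaseChange_tmul, hX, one_smul] at h

theorem natCast_le_trdeg_of_succ_le {k F K : Type*} [Field k] [Field F] [Field K] [Algebra k F]
    [Algebra k K] [Algebra F K] [IsScalarTower k F K] (hF : Algebra.trdeg k F = 1) {n : ℕ}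
    (hn : ((n + 1 : ℕ) : Cardinal) ≤ Algebra.trdeg k K) : (n : Cardinal) ≤ Algebra.trdeg F K := by
  have h := lift_trdeg_add_eq k F K
  rw [hF, Cardinal.lift_one, add_comm] at h
  have h' : ((n + 1 : ℕ) : Cardinal) ≤ Cardinal.lift (Algebra.trdeg F K) + 1 := by
    rw [h]
    simpa using hn
  rw [Nat.cast_succ, Cardinal.add_one_le_add_one_iff] at h'
  simpa using h'

theorem Polynomial.trdeg_fractionRing (k : Type*) [Field k] :
    Algebra.trdeg k (FractionRing (Polynomial k)) = 1 := by
  rw [← trdeg_add_eq k (Polynomial k) (A := FractionRing (Polynomial k)),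
    Polynomial.trdeg_of_isDomain]
  have : Algebra.IsAlgebraic (Polynomial k) (FractionRing (Polynomial k)) :=
    IsLocalization.isAlgebraic _ (nonZeroDivisors (Polynomial k))
  rw [trdeg_eq_zero, add_zero]

/-- Embed `F = k(X)` by `X ↦ x` and `X ↦ y`. The surjection `K ⊗[k] L → K ⊗[F] L` kills the regular
element `x ⊗ 1 - 1 ⊗ y`, and over `F` both transcendence degrees are still at least `n`. The base
field varies in the induction. -/
theorem natCast_le_ringKrullDim_tensorProduct (n : ℕ) : ∀ (k K L : Type*) [Field k] [Field K]
    [Field L] [Algebra k K] [Algebra k L] (_ : (n : Cardinal) ≤ Algebra.trdeg k K)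
    (_ : (n : Cardinal) ≤ Algebra.trdeg k L), (n : WithBot ℕ∞) ≤ ringKrullDim (K ⊗[k] L) := by
  induction n with
  | zero =>
    intro k K L _ _ _ _ _ _ _
    exact ringKrullDim_nonneg_of_nontrivial
  | succ n ih =>
    intro k K L _ _ _ _ _ hK hL
    have : Algebra.Transcendental k K := trdeg_ne_zero_iff.mp fun h ↦ by
      rw [h] at hK; exact absurd hK (by simp)
    have : Algebra.Transcendental k L := trdeg_ne_zero_iff.mp fun h ↦ by
      rw [h] at hL; exact absurd hL (by simp)
    obtain ⟨x, hx⟩ := Algebra.Transcendental.transcendental (R := k) (A := K)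
    obtain ⟨y, hy⟩ := Algebra.Transcendental.transcendental (R := k) (A := L)
    let F := FractionRing (Polynomial k)
    let i : F →ₐ[k] K := IsFractionRing.liftAlgHom (g := Polynomial.aeval x)
      (transcendental_iff_injective.mp hx)
    let j : F →ₐ[k] L := IsFractionRing.liftAlgHom (g := Polynomial.aeval y)
      (transcendental_iff_injective.mp hy)
    let : Algebra F K := i.toAlgebra
    let : Algebra F L := j.toAlgebra
    have : IsScalarTower k F K := IsScalarTower.of_algebraMap_eq fun a ↦ (i.commutes a).symm
    have : IsScalarTower k F L := IsScalarTower.of_algebraMap_eq fun a ↦ (j.commutes a).symm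
    have h1 := ih F K L (natCast_le_trdeg_of_succ_le (Polynomial.trdeg_fractionRing k) hK)
      (natCast_le_trdeg_of_succ_le (Polynomial.trdeg_fractionRing k) hL)
    have hix : algebraMap F K (algebraMap (Polynomial k) F .X) = x :=
      (IsFractionRing.lift_algebraMap (transcendental_iff_injective.mp hx) _).trans
        (Polynomial.aeval_X x)
    have hjy : algebraMap F L (algebraMap (Polynomial k) F .X) = y :=
      (IsFractionRing.lift_algebraMap (transcendental_iff_injective.mp hy) _).trans
        (Polynomial.aeval_X y)
    have h2 := ringKrullDim_succ_le_of_surjective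
      (Algebra.TensorProduct.mapOfCompatibleSMul F k k K L).toRingHom
      (Algebra.TensorProduct.mapOfCompatibleSMul_surjective F k k K L)
      (tmul_one_sub_one_tmul_mem_nonZeroDivisors hx y) (by
        change Algebra.TensorProduct.mapOfCompatibleSMul F k k K L (x ⊗ₜ 1 - 1 ⊗ₜ y) = 0
        rw [map_sub, Algebra.TensorProduct.mapOfCompatibleSMul_tmul,
          Algebra.TensorProduct.mapOfCompatibleSMul_tmul, ← hix, ← hjy, sub_eq_zero]
        exact Algebra.TensorProduct.tmul_one_eq_one_tmul _)
    rw [Nat.cast_succ]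
    exact le_trans (by gcongr) h2

/-- The Krull dimension of a tensor product of fields is the smaller of the two transcendence
degrees. -/
theorem ringKrullDim_tensorProduct_eq_min_trdegENat (k K L : Type*) [Field k] [Field K] [Field L]
    [Algebra k K] [Algebra k L] :
    ringKrullDim (K ⊗[k] L) = (min (trdegENat k K) (trdegENat k L) : ℕ∞) := by
  refine le_antisymm ?_ ?_
  · rw [WithBot.coe_min]
    refine le_min (ringKrullDim_tensorProduct_le_trdegENat k K L) ?_
    rw [ringKrullDim_tensorProduct_comm]
    exact ringKrullDim_tensorProduct_le_trdegENat k L K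
  · have hne : (0 : WithBot ℕ∞) ≤ ringKrullDim (K ⊗[k] L) := ringKrullDim_nonneg_of_nontrivial
    obtain ⟨d, hd⟩ := WithBot.ne_bot_iff_exists.mp (ne_bot_of_le_ne_bot (by simp) hne)
    rw [← hd, WithBot.coe_le_coe]
    -- Testing against natural numbers covers the infinite case too.
    refine ENat.forall_natCast_le_iff_le.mp fun n hn ↦ ?_
    have hn' := le_min_iff.mp hn
    have := natCast_le_ringKrullDim_tensorProduct n k K L
      (Cardinal.natCast_le_toENat.mp hn'.1) (Cardinal.natCast_le_toENat.mp hn'.2)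
    rw [← hd] at this
    exact WithBot.coe_le_coe.mp this

/-! ### The dimension formula and finiteness -/

theorem corollary3p2 (k A B : Type*) [Field k] [CommRing A] [CommRing B]
    [IsLocalRing A] [IsLocalRing B] [IsNoetherianRing A] [IsNoetherianRing B]
    [Algebra k A] [Algebra k B]
    (hE : IsNoetherianRing (LocalCompletedTensorProduct k A B)) :
    ringKrullDim (LocalCompletedTensorProduct k A B) =
        ringKrullDim A + ringKrullDim B +
          ((min (trdegENat k (IsLocalRing.ResidueField A))
            (trdegENat k (IsLocalRing.ResidueField B)) : ℕ∞) : WithBot ℕ∞) ∧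
      (FiniteRingKrullDim (LocalCompletedTensorProduct k A B) ↔
        Algebra.trdeg k (IsLocalRing.ResidueField A) < Cardinal.aleph0 ∨
          Algebra.trdeg k (IsLocalRing.ResidueField B) < Cardinal.aleph0) := by
  have h := le_antisymm (ringKrullDim_le_add_ringKrullDim_tensorProduct_residueField k A B)
    (add_ringKrullDim_tensorProduct_residueField_le k A B)
  rw [ringKrullDim_tensorProduct_eq_min_trdegENat] at h
  refine ⟨h, ?_⟩
  obtain ⟨l, hl⟩ := exists_ltSeries_length_eq_ringKrullDim A
  obtain ⟨l', hl'⟩ := exists_ltSeries_length_eq_ringKrullDim B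
  have h' : ringKrullDim (LocalCompletedTensorProduct k A B) =
      ((l.length + l'.length + min (trdegENat k (IsLocalRing.ResidueField A))
        (trdegENat k (IsLocalRing.ResidueField B)) : ℕ∞) : WithBot ℕ∞) := by
    rw [h, ← hl, ← hl']
    rfl
  -- Noetherian local rings have finite dimension, so only the minimum can make the sum infinite.
  have hfin (n m : ℕ) (c : ℕ∞) : (n + m + c : ℕ∞) = ⊤ ↔ c = ⊤ := by
    rw [← Nat.cast_add, ENat.add_eq_top]
    simp
  rw [finiteRingKrullDim_iff_ne_bot_and_top, h', ← Cardinal.toENat_lt_top,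
    ← Cardinal.toENat_lt_top, ← min_lt_iff, lt_top_iff_ne_top]
  exact ⟨fun h hc ↦ h.2 (congrArg _ ((hfin _ _ _).mpr hc)), fun h ↦
    ⟨WithBot.coe_ne_bot, fun hc ↦ h ((hfin _ _ _).mp (WithBot.coe_injective hc))⟩⟩
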